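/- Let $n\in\mathbb N$, let $\mathbb D$ be the open unit disc, and let $b$ be an analytic function on $\mathbb D$ with values in the $n\times n$ complex matrices and with $\|b(z)\|<1$ (operator norm) for all $z\in\mathbb D$. Let $\alpha$ be a unitary $n\times n$ matrix and let $|\lambda|=1$. The notation $z\overset{\sphericalangle}{\to}\lambda$ means that $z\to\lambda$ inside Stolz regions $\{z\in\mathbb D:|z-\lambda|<t(1-|z|)\}$, $t>1$; a limit as $z\overset{\sphericalangle}{\to}\lambda$ is required to exist, with the same value, in each of these regions, and a lower limit is $<\infty$ when it is finite in at least one of them. Let $\mathscr H(b)$ be the de Branges–Rovnyak space, i.e. the Hilbert space of $\mathbb C^n$-valued functions on $\mathbb D$ with reproducing kernel $k^b(z,w)=\dfrac{I-b(z)b(w)^*}{1-z\overline w}$. Inner products are linear in the first variable. Put $$\mathbf E_\alpha(\lambda)=\Big\{\mathbf x\in\mathbb C^n:\ \lim_{z\overset{\sphericalangle}{\to}\lambda}b(z)^*\mathbf x=\alpha^*\mathbf x\ \text{ and }\ \liminf_{z\overset{\sphericalangle}{\to}\lambda}\frac{\|\mathbf x\|^2-\|b(z)^*\mathbf x\|^2}{1-|z|^2}<\infty\Big\}.$$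 Then $E:=\mathbf E_\alpha(\lambda)$ is a linear subspace of $\mathbb C^n$, and $b\alpha^*$ has a Carathéodory angular derivative at $\lambda$ on $E$; that is, $\lim_{z\overset{\sphericalangle}{\to}\lambda}b(z)\alpha^*\mathbf e=\mathbf e$ for every $\mathbf e\in E$, and the limit $$\operatorname{CAD}_E(b\alpha^*)(\lambda):=\lim_{z\overset{\sphericalangle}{\to}\lambda}P_E\,(b\alpha^*)'(z)\,P_E$$ exists, where $P_E$ is the orthogonal projection onto $E$. Moreover, for every $\mathbf x\in E$ the boundary reproducing kernel $$k^b_{\lambda,\mathbf x}(z)=\frac{\mathbf x-b(z)\,b^*(\lambda,\mathbf x)}{1-z\overline\lambda},\qquad b^*(\lambda,\mathbf x):=\lim_{z\overset{\sphericalangle}{\to}\lambda}b(z)^*\mathbf x,$$ belongs to $\mathscr H(b)$, and for all $\mathbf x,\mathbf y\in E$ $$\lambda\,\big(\operatorname{CAD}_E(b\alpha^*)(\lambda)\,\mathbf x,\mathbf y\big)_{\mathbb C^n}=\big\langle k^b_{\lambda,\mathbf x},k^b_{\lambda,\mathbf y}\big\rangle_{\mathscr H(b)}.$$ -/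

import Mathlib

open Complex Filter Metric Set
open scoped Topology UnitDisc InnerProductSpace ComplexConjugate

/-- Complex Euclidean space `ℂⁿ`, with its standard inner product. -/
abbrev CVec (n : ℕ) : Type := EuclideanSpace ℂ (Fin n)

/-- Complex `n × n` matrices, regarded as linear operators on `ℂⁿ` and equipped with the operator
norm. -/
abbrev CMat (n : ℕ) : Type := CVec n →L[ℂ] CVec n

/-- The matrix-valued Schur class: analytic purely contractive functions on the open unit disc.
The values of `toFun` outside the disc are irrelevant. -/
structure SchurFunction (n : ℕ) where
  /-- The underlying function. -/
  toFun : ℂ → CMat n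
  differentiableOn : DifferentiableOn ℂ toFun (ball 0 1)
  norm_lt_one : ∀ z ∈ ball (0 : ℂ) 1, ‖toFun z‖ < 1

noncomputable instance (n : ℕ) : CoeFun (SchurFunction n) (fun _ => ℂ → CMat n) := ⟨SchurFunction.toFun⟩

/-- The Stolz region `{z ∈ 𝔻 : |z - lam| < t (1 - |z|)}`. -/
def stolzRegion (t : ℝ) (lam : ℂ) : Set ℂ :=
  {z : ℂ | ‖z‖ < 1 ∧ ‖z - lam‖ < t * (1 - ‖z‖)}

/-- The filter of non-tangential approach to `lam`. A function tends to a limit along it iff it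
does so inside every Stolz region of aperture `t > 1`. -/
noncomputable def nonTangential (lam : ℂ) : Filter ℂ :=
  ⨆ t ∈ Ioi (1 : ℝ), 𝓝[stolzRegion t lam] lam

theorem tendsto_nonTangential_iff {X : Type*} (f : ℂ → X) (lam : ℂ) (l : Filter X) :
    Tendsto f (nonTangential lam) l ↔
      ∀ t : ℝ, 1 < t → Tendsto f (𝓝[stolzRegion t lam] lam) l := by
  simp [nonTangential, tendsto_iSup]

/-! ### The de Branges--Rovnyak space -/

/-- The kernel `k^b(z, w) = (I - b(z) b(w)^*) / (1 - z \bar w)`. -/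
noncomputable def dBRKernel {n : ℕ} (b : SchurFunction n) : Matrix 𝔻 𝔻 (CMat n) :=
  Matrix.of fun z w : 𝔻 =>
    (1 - (z : ℂ) * conj (w : ℂ))⁻¹ • (1 - b z ∘L ContinuousLinearMap.adjoint (b w))

theorem dBR_one_sub_ne_zero {z w : ℂ} (hz : ‖z‖ ≤ 1) (hw : ‖w‖ < 1) : 1 - z * conj w ≠ 0 := by
  intro h
  have h1 : z * conj w = 1 := (sub_eq_zero.mp h).symm
  have h2 : ‖z‖ * ‖w‖ = 1 := by simpa using congrArg norm h1
  nlinarith [norm_nonneg z, norm_nonneg w]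

/-- Cauchy's formula, as the reproducing property of the Szegő kernel. -/
theorem dBR_cauchy {h : ℂ → ℂ} (hh : DiffContOnCl ℂ h (ball 0 1)) {w : ℂ} (hw : ‖w‖ < 1) :
    Real.circleAverage (fun ζ => conj ((1 - ζ * conj w)⁻¹) * h ζ) 0 1 = h w := by
  have h1 := DiffContOnCl.circleAverage_smul_div (f := h) (c := 0) (R := 1) (w := w)
    (by simpa using hh) (by simpa using hw)
  rw [← h1]
  refine Real.circleAverage_congr_sphere fun ζ hζ => ?_
  have hζ' : ‖ζ‖ = 1 := by simpa using hζ
  have hc : conj ζ * ζ = 1 := by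
    rw [← Complex.normSq_eq_conj_mul_self, Complex.normSq_eq_norm_sq, hζ']; simp
  have hne : ζ - w ≠ 0 := by
    intro h0
    rw [sub_eq_zero.mp h0] at hζ'
    linarith
  have hne2 : 1 - conj ζ * w ≠ 0 := by
    have := dBR_one_sub_ne_zero (z := conj ζ) (w := conj w) (by simp [hζ']) (by simpa using hw)
    simpa using this
  simp only [map_inv₀, map_sub, map_one, map_mul, Complex.conj_conj, sub_zero, smul_eq_mul]
  congr 1
  rw [inv_eq_one_div, div_eq_div_iff hne2 hne]
  linear_combination w * hc

/-- The same for vector-valued functions, tested against a combination of Szegő kernels. -/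
theorem dBR_cauchy_sum {n : ℕ} {h : ℂ → CVec n} (hh : DiffContOnCl ℂ h (ball 0 1))
    (s : Finset 𝔻) (x : 𝔻 → CVec n) :
    Real.circleAverage
      (fun ζ => ⟪∑ i ∈ s, (1 - ζ * conj (i : ℂ))⁻¹ • x i, h ζ⟫_ℂ) 0 1
      = ∑ i ∈ s, ⟪x i, h i⟫_ℂ := by
  have hd : ∀ i : 𝔻, DiffContOnCl ℂ (fun ζ => ⟪x i, h ζ⟫_ℂ) (ball 0 1) := fun i =>
    (innerSL ℂ (x i)).differentiable.comp_diffContOnCl hh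
  have hcont : ContinuousOn h (closedBall 0 1) := hh.continuousOn_ball
  simp only [sum_inner, inner_smul_left]
  rw [Real.circleAverage_fun_sum]
  · exact Finset.sum_congr rfl fun i _ => dBR_cauchy (hd i) i.norm_lt_one
  · intro i _
    refine ContinuousOn.circleIntegrable' ?_
    have hs : sphere (0 : ℂ) |1| ⊆ closedBall 0 1 := by simpa using sphere_subset_closedBall
    refine ContinuousOn.mul ?_ ((hd i).continuousOn_ball.mono hs)
    refine Complex.continuous_conj.comp_continuousOn (ContinuousOn.inv₀ (by fun_prop) ?_)
    intro ζ hζ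
    exact dBR_one_sub_ne_zero (by simpa using hs hζ) i.norm_lt_one

/-- Positivity of the kernel, for a function that is regular up to the boundary. -/
theorem dBR_pos_aux {n : ℕ} {f : ℂ → CMat n} (hf : DiffContOnCl ℂ f (ball 0 1))
    (hf1 : ∀ z ∈ closedBall (0 : ℂ) 1, ‖f z‖ ≤ 1) (s : Finset 𝔻) (x : 𝔻 → CVec n) :
    0 ≤ (∑ i ∈ s, ∑ j ∈ s, (1 - (i : ℂ) * conj (j : ℂ))⁻¹ *
      (⟪x i, x j⟫_ℂ - ⟪ContinuousLinearMap.adjoint (f i) (x i),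
        ContinuousLinearMap.adjoint (f j) (x j)⟫_ℂ)).re := by
  set y : 𝔻 → CVec n := fun i => ContinuousLinearMap.adjoint (f i) (x i) with hy
  set F : ℂ → CVec n := fun ζ => ∑ i ∈ s, (1 - ζ * conj (i : ℂ))⁻¹ • x i with hF
  set G : ℂ → CVec n := fun ζ => ∑ i ∈ s, (1 - ζ * conj (i : ℂ))⁻¹ • y i with hG
  have hreg : ∀ v : 𝔻 → CVec n, DiffContOnCl ℂ
      (fun ζ => ∑ i ∈ s, (1 - ζ * conj (i : ℂ))⁻¹ • v i) (ball 0 1) := by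
    intro v
    refine DifferentiableOn.diffContOnCl_ball (U := closedBall 0 1) ?_ subset_rfl
    refine DifferentiableOn.fun_sum fun i _ => ?_
    refine DifferentiableOn.smul_const (DifferentiableOn.fun_inv (by fun_prop) ?_) _
    intro ζ hζ
    exact dBR_one_sub_ne_zero (by simpa using hζ) i.norm_lt_one
  have hFr : DiffContOnCl ℂ F (ball 0 1) := hreg x
  have hGr : DiffContOnCl ℂ G (ball 0 1) := hreg y
  have hfG : DiffContOnCl ℂ (fun ζ => f ζ (G ζ)) (ball 0 1) :=
    ⟨hf.differentiableOn.clm_apply hGr.differentiableOn, hf.continuousOn.clm_apply hGr.continuousOn⟩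
  have e1 := dBR_cauchy_sum hFr s x
  have e2 := dBR_cauchy_sum hfG s x
  have e3 := dBR_cauchy_sum hGr s y
  have e23 : ∑ i ∈ s, ⟪x i, f i (G i)⟫_ℂ = ∑ i ∈ s, ⟪y i, G i⟫_ℂ :=
    Finset.sum_congr rfl fun i _ => by rw [hy, ContinuousLinearMap.adjoint_inner_left]
  have hs : sphere (0 : ℂ) |1| ⊆ closedBall 0 1 := by simpa using sphere_subset_closedBall
  have cF := hFr.continuousOn_ball.mono hs
  have cG := hGr.continuousOn_ball.mono hs
  have cfG := hfG.continuousOn_ball.mono hs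
  have i1 : CircleIntegrable (fun ζ => ⟪F ζ, F ζ⟫_ℂ) 0 1 := (cF.inner cF).circleIntegrable'
  have i2 : CircleIntegrable (fun ζ => ⟪F ζ, f ζ (G ζ)⟫_ℂ) 0 1 :=
    (cF.inner cfG).circleIntegrable'
  have i3 : CircleIntegrable (fun ζ => ⟪G ζ, G ζ⟫_ℂ) 0 1 := (cG.inner cG).circleIntegrable'
  have hpt : 0 ≤ Real.circleAverage (fun ζ => Complex.reCLM
      (⟪F ζ, F ζ⟫_ℂ - (⟪F ζ, f ζ (G ζ)⟫_ℂ + ⟪F ζ, f ζ (G ζ)⟫_ℂ) + ⟪G ζ, G ζ⟫_ℂ)) 0 1 := by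
    refine Real.circleAverage_nonneg_of_nonneg fun ζ hζ => ?_
    have hle : ‖f ζ (G ζ)‖ ≤ ‖G ζ‖ := (f ζ).le_of_opNorm_le_of_le (hf1 ζ (hs hζ)) le_rfl |>.trans
      (by simp)
    have h0 : 0 ≤ ‖F ζ - f ζ (G ζ)‖ ^ 2 := by positivity
    rw [norm_sub_sq (𝕜 := ℂ)] at h0
    have hF2 : (⟪F ζ, F ζ⟫_ℂ).re = ‖F ζ‖ ^ 2 := inner_self_eq_norm_sq (𝕜 := ℂ) (F ζ)
    have hG2 : (⟪G ζ, G ζ⟫_ℂ).re = ‖G ζ‖ ^ 2 := inner_self_eq_norm_sq (𝕜 := ℂ) (G ζ)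
    simp only [Complex.reCLM_apply, Complex.add_re, Complex.sub_re, hF2, hG2]
    simp only [RCLike.re_to_complex] at h0
    nlinarith [norm_nonneg (f ζ (G ζ)), norm_nonneg (G ζ)]
  have hcomm := Complex.reCLM.circleAverage_comp_comm
    (f := fun ζ => ⟪F ζ, F ζ⟫_ℂ - (⟪F ζ, f ζ (G ζ)⟫_ℂ + ⟪F ζ, f ζ (G ζ)⟫_ℂ) + ⟪G ζ, G ζ⟫_ℂ)
    (c := 0) (R := 1) ((i1.fun_sub (i2.fun_add i2)).fun_add i3)
  rw [Function.comp_def] at hcomm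
  rw [hcomm, Real.circleAverage_fun_add (i1.fun_sub (i2.fun_add i2)) i3,
    Real.circleAverage_fun_sub i1 (i2.fun_add i2), Real.circleAverage_fun_add i2 i2, e1, e2, e3,
    e23, Complex.reCLM_apply] at hpt
  refine hpt.trans_eq (congrArg Complex.re ?_)
  have t1 : ∑ i ∈ s, ⟪x i, F i⟫_ℂ =
      ∑ i ∈ s, ∑ j ∈ s, (1 - (i : ℂ) * conj (j : ℂ))⁻¹ * ⟪x i, x j⟫_ℂ := by
    simp only [hF, inner_sum, inner_smul_right]
  have t2 : ∑ i ∈ s, ⟪y i, G i⟫_ℂ =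
      ∑ i ∈ s, ∑ j ∈ s, (1 - (i : ℂ) * conj (j : ℂ))⁻¹ * ⟪y i, y j⟫_ℂ := by
    simp only [hG, inner_sum, inner_smul_right]
  simp only [mul_sub, Finset.sum_sub_distrib]
  rw [t1, t2]
  ring

theorem dBRKernel_isHermitian {n : ℕ} (b : SchurFunction n) : (dBRKernel b).IsHermitian := by
  ext1 z w
  simp only [Matrix.conjTranspose_apply, dBRKernel, Matrix.of_apply, star_smul,
    ContinuousLinearMap.star_eq_adjoint, map_sub, ContinuousLinearMap.adjoint_comp,
    ContinuousLinearMap.adjoint_adjoint]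
  congr 1
  · simp [mul_comm]
  · rw [← ContinuousLinearMap.star_eq_adjoint, star_one]

/-- The de Branges--Rovnyak kernel is positive semidefinite. -/
theorem dBRKernel_posSemidef {n : ℕ} (b : SchurFunction n) : (dBRKernel b).PosSemidef := by
  have htfae := (RKHS.posSemidef_tfae (K := dBRKernel b)).out 0 2
  refine htfae.mpr ⟨dBRKernel_isHermitian b, fun v => ?_⟩
  have key : ∀ r ∈ Ioo (0 : ℝ) 1, 0 ≤ (∑ i ∈ v.support, ∑ j ∈ v.support,
      (1 - (i : ℂ) * conj (j : ℂ))⁻¹ * (⟪v i, v j⟫_ℂ -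
        ⟪ContinuousLinearMap.adjoint (b (r * (i : ℂ))) (v i),
          ContinuousLinearMap.adjoint (b (r * (j : ℂ))) (v j)⟫_ℂ)).re := by
    intro r hr
    have hm : ∀ z ∈ closedBall (0 : ℂ) 1, (r : ℂ) * z ∈ ball (0 : ℂ) 1 := by
      intro z hz
      have hz' : ‖z‖ ≤ 1 := by simpa using hz
      simp only [mem_ball_zero_iff, norm_mul, Complex.norm_real, Real.norm_eq_abs, abs_of_pos hr.1]
      nlinarith [hr.1, hr.2, norm_nonneg z]
    refine dBR_pos_aux (f := fun z => b (r * z)) ?_ (fun z hz => (b.norm_lt_one _ (hm z hz)).le) _ _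
    refine DifferentiableOn.diffContOnCl_ball (U := closedBall 0 1) ?_ subset_rfl
    exact b.differentiableOn.comp (by fun_prop) hm
  have hlim : Tendsto (fun r : ℝ => (∑ i ∈ v.support, ∑ j ∈ v.support,
      (1 - (i : ℂ) * conj (j : ℂ))⁻¹ * (⟪v i, v j⟫_ℂ -
        ⟪ContinuousLinearMap.adjoint (b (r * (i : ℂ))) (v i),
          ContinuousLinearMap.adjoint (b (r * (j : ℂ))) (v j)⟫_ℂ)).re) (𝓝[<] 1)
      (𝓝 (∑ i ∈ v.support, ∑ j ∈ v.support,
      (1 - (i : ℂ) * conj (j : ℂ))⁻¹ * (⟪v i, v j⟫_ℂ -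
        ⟪ContinuousLinearMap.adjoint (b (i : ℂ)) (v i),
          ContinuousLinearMap.adjoint (b (j : ℂ)) (v j)⟫_ℂ)).re) := by
    have hb : ∀ i : 𝔻, Tendsto (fun r : ℝ => ContinuousLinearMap.adjoint (b (r * (i : ℂ))) (v i))
        (𝓝[<] 1) (𝓝 (ContinuousLinearMap.adjoint (b (i : ℂ)) (v i))) := by
      intro i
      have hi : (i : ℂ) ∈ ball (0 : ℂ) 1 := by simpa using i.norm_lt_one
      have c1 : ContinuousAt b.toFun (((1 : ℝ) : ℂ) * (i : ℂ)) := by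
        simpa using (b.differentiableOn.differentiableAt (isOpen_ball.mem_nhds hi)).continuousAt
      have c2 : ContinuousAt (fun r : ℝ => b ((r : ℂ) * (i : ℂ))) 1 :=
        ContinuousAt.comp (f := fun r : ℝ => (r : ℂ) * (i : ℂ)) c1 (by fun_prop)
      have c3 : ContinuousAt
          (fun r : ℝ => ContinuousLinearMap.adjoint (b ((r : ℂ) * (i : ℂ))) (v i)) 1 :=
        ((ContinuousLinearMap.adjoint (𝕜 := ℂ) (E := CVec n)
          (F := CVec n)).continuous.continuousAt.comp c2).clm_apply continuousAt_const
      simpa [ContinuousAt] using c3.tendsto.mono_left nhdsWithin_le_nhds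
    refine (Complex.continuous_re.tendsto _).comp ?_
    exact tendsto_finsetSum _ fun i _ => tendsto_finsetSum _ fun j _ =>
      (tendsto_const_nhds.sub ((hb i).inner (hb j))).const_mul _
  have hnn := ge_of_tendsto hlim (by
    filter_upwards [Ioo_mem_nhdsLT (zero_lt_one (α := ℝ))] with r hr using key r hr)
  refine hnn.trans_eq ?_
  rw [← Complex.conj_re, RCLike.re_to_complex]
  congr 1
  simp only [Finsupp.sum, dBRKernel, Matrix.of_apply, map_sum]
  rw [Finset.sum_comm]
  refine Finset.sum_congr rfl fun i _ => Finset.sum_congr rfl fun j _ => ?_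
  simp only [map_mul, map_sub, inner_conj_symm, FunLike.coe_smul, FunLike.coe_sub, Pi.smul_apply, Pi.sub_apply,
    one_apply_eq_self, ContinuousLinearMap.comp_apply, inner_smul_left, inner_sub_left]
  rw [← ContinuousLinearMap.adjoint_inner_right (b j)]

instance {n : ℕ} (b : SchurFunction n) : Fact (dBRKernel b).PosSemidef := ⟨dBRKernel_posSemidef b⟩

/-- The de Branges--Rovnyak space `H(b)`: the Hilbert space of `ℂⁿ`-valued functions on `𝔻` with
reproducing kernel `k^b`. -/
abbrev DeBrangesRovnyak {n : ℕ} (b : SchurFunction n) : Type := RKHS.OfKernel (dBRKernel b)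

/-- The reproducing property: `⟨f, k^b_w e⟩_{H(b)} = (f(w), e)`, in Mathlib's convention that inner
products are conjugate-linear in the first variable. -/
theorem DeBrangesRovnyak.reproducing {n : ℕ} (b : SchurFunction n) (w : 𝔻) (e : CVec n) :
    ∃ k : DeBrangesRovnyak b,
      (∀ z : 𝔻, k z = (1 - (z : ℂ) * conj (w : ℂ))⁻¹ •
        (e - b z (ContinuousLinearMap.adjoint (b w) e))) ∧
      ∀ f : DeBrangesRovnyak b, ⟪k, f⟫_ℂ = ⟪e, f w⟫_ℂ :=
  ⟨RKHS.kerFun (DeBrangesRovnyak b) w e,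
    fun z => by rw [RKHS.kerFun_apply, RKHS.OfKernel.kernel_ofKernel]; simp [dBRKernel],
    fun f => RKHS.kerFun_inner w e f⟩

/-! ### Carathéodory condition and angular derivatives -/

/-- The Carathéodory condition for `b` at `lam` in the codirection `x`. The lower limit is taken in
the extended reals. -/
def CaratheodoryCondition {n : ℕ} (b : SchurFunction n) (lam : ℂ) (x : CVec n) : Prop :=
  liminf (fun z : ℂ =>
    (((‖x‖ ^ 2 - ‖ContinuousLinearMap.adjoint (b z) x‖ ^ 2) / (1 - ‖z‖ ^ 2) : ℝ) : EReal))
    (nonTangential lam) < ⊤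

/-- The directional carrier `S_α(lam)`. -/
def directionalCarrier {n : ℕ} (b : SchurFunction n) (α : unitary (CMat n)) (lam : ℂ) :
    Set (CVec n) :=
  {e | Tendsto (fun z => ContinuousLinearMap.adjoint (b z) e) (nonTangential lam)
    (𝓝 (ContinuousLinearMap.adjoint (α : CMat n) e))}

/-- The set `E_α(lam)` of those vectors of `S_α(lam)` in whose codirection `b` satisfies the
Carathéodory condition at `lam`. -/
def caratheodoryCodirections {n : ℕ} (b : SchurFunction n) (α : unitary (CMat n)) (lam : ℂ) :
    Set (CVec n) :=
  {x | x ∈ directionalCarrier b α lam ∧ CaratheodoryCondition b lam x}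

/-- `f` has the Carathéodory angular derivative `A` at `lam` on the subspace `E`. Here
`E.starProjection` is the orthogonal projection onto `E`, as an operator on `ℂⁿ`. -/
def HasCADOn {n : ℕ} (f : ℂ → CMat n) (lam : ℂ) (E : Submodule ℂ (CVec n)) (A : CMat n) : Prop :=
  (∀ e ∈ E, Tendsto (fun z => f z e) (nonTangential lam) (𝓝 e)) ∧
  Tendsto (fun z => E.starProjection ∘L deriv f z ∘L E.starProjection) (nonTangential lam) (𝓝 A)

/-- `k` is the boundary reproducing kernel `k^b_{lam,x}` of `H(b)`, that is the element of `H(b)`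
given by `k(z) = (x - b(z) x') / (1 - z \bar lam)`, where `x'` is the non-tangential limit of
`b(z)^* x` at `lam`. -/
def IsBoundaryKernel {n : ℕ} (b : SchurFunction n) (lam : ℂ) (x : CVec n)
    (k : DeBrangesRovnyak b) : Prop :=
  ∃ x' : CVec n,
    Tendsto (fun z => ContinuousLinearMap.adjoint (b z) x) (nonTangential lam) (𝓝 x') ∧
    ∀ z : 𝔻, k z = (1 - (z : ℂ) * conj lam)⁻¹ • (x - b z x')

/-! The Carathéodory quotient at `w` equals `‖k^b_w x‖²`, so a finite lower limit says that the
kernels `k^b_w x` stay bounded along some non-tangential approach to `lam`. A weak limit of them has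
the point values `(x - b(z) x') / (1 - z \bar lam)`, hence is the boundary kernel
(`exists_boundaryKernel_of_ultrafilter`). Conversely, if that kernel lies in `H(b)` and `‖x'‖ =
‖x‖`, pairing it with `k^b_w x` bounds the latter on every Stolz region (`norm_dBRKerFun_mul_le`).
Thus, for `x` in the directional carrier, the Carathéodory condition says that a function depending
linearly on `x` lies in `H(b)`. So `E` is a subspace, and on it the kernels converge weakly and
non-tangentially to the boundary kernels (`tendsto_dBRKerFun_inner`).

Testing this convergence on the boundary kernel of `y` gives the limit of the scalar difference
quotient `(x, y - b(w) α^* y) / (1 - w \bar lam)`. Cauchy's estimate turns it into a limit of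
derivatives (`tendsto_deriv_nonTangential`), and in finite dimension these entries determine the
operator limit. -/

/-! ### Hilbert space preliminaries. -/

/-- Bounded families in a Hilbert space converge weakly along ultrafilters. -/
theorem exists_tendsto_inner_of_bounded {ι H : Type*} [NormedAddCommGroup H]
    [InnerProductSpace ℂ H] [CompleteSpace H] (u : Ultrafilter ι) (v : ι → H) (C : ℝ)
    (hv : ∀ᶠ i in (u : Filter ι), ‖v i‖ ≤ C) :
    ∃ h : H, ∀ f : H, Tendsto (fun i => ⟪v i, f⟫_ℂ) u (𝓝 ⟪h, f⟫_ℂ) := by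
  let T : ι → WeakDual ℂ H := fun i => WeakDual.toStrongDual.symm (innerSL ℂ (v i))
  -- Banach–Alaoglu for the functionals `⟪v i, ·⟫`; Riesz representation then turns the limit
  -- functional into a vector.
  obtain ⟨φ, -, hφ⟩ := (WeakDual.isCompact_closedBall (𝕜 := ℂ) (E := H) 0 C).ultrafilter_le_nhds
    (u.map T) (by
      rw [le_principal_iff]
      refine Eventually.mono (f := (u : Filter ι)) hv fun i hi => ?_
      simpa [T] using hi)
  refine ⟨(InnerProductSpace.toDual ℂ H).symm (WeakDual.toStrongDual φ), fun f => ?_⟩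
  rw [InnerProductSpace.toDual_symm_apply]
  have h1 : Tendsto T u (𝓝 φ) := hφ
  exact ((WeakDual.eval_continuous (𝕜 := ℂ) f).tendsto φ).comp h1

/-- In finite dimension, operators converge in norm as soon as their entries do. -/
theorem tendsto_clm_of_tendsto_inner {ι E : Type*} [NormedAddCommGroup E]
    [InnerProductSpace ℂ E] [FiniteDimensional ℂ E] {l : Filter ι} {T : ι → E →L[ℂ] E}
    {A : E →L[ℂ] E}
    (h : ∀ u v : E, Tendsto (fun i => ⟪u, T i v⟫_ℂ) l (𝓝 ⟪u, A v⟫_ℂ)) : Tendsto T l (𝓝 A) := by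
  let e := stdOrthonormalBasis ℂ E
  have key : ∀ S : E →L[ℂ] E,
      ∑ i, ∑ j, ⟪e i, S (e j)⟫_ℂ • InnerProductSpace.rankOne ℂ (e i) (e j) = S := by
    intro S
    ext x
    have hx : S x = ∑ j, ⟪e j, x⟫_ℂ • S (e j) := by
      conv_lhs => rw [← e.sum_repr' x]
      simp
    simp only [sum_apply, smul_apply,
      InnerProductSpace.rankOne_apply]
    rw [Finset.sum_comm, hx]
    refine Finset.sum_congr rfl fun j _ => ?_
    conv_rhs => rw [← e.sum_repr' (S (e j)), Finset.smul_sum]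
    exact Finset.sum_congr rfl fun i _ => smul_comm _ _ _
  rw [← key A]
  exact (tendsto_finsetSum Finset.univ fun i _ => tendsto_finsetSum Finset.univ fun j _ =>
    (h (e i) (e j)).smul_const (InnerProductSpace.rankOne ℂ (e i) (e j))).congr fun i => key (T i)

/-! ### Non-tangential approach and angular derivatives of scalar functions. -/

theorem norm_one_sub_mul_conj {lam : ℂ} (hlam : ‖lam‖ = 1) (w : ℂ) :
    ‖1 - w * conj lam‖ = ‖w - lam‖ := by
  have h : lam * conj lam = 1 := by simp [Complex.mul_conj, Complex.normSq_eq_norm_sq, hlam]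
  rw [← h, ← sub_mul, norm_mul, RCLike.norm_conj, hlam, mul_one, norm_sub_rev]

theorem nhdsWithin_stolzRegion_le_nonTangential {t : ℝ} (ht : 1 < t) (lam : ℂ) :
    𝓝[stolzRegion t lam] lam ≤ nonTangential lam :=
  le_iSup₂_of_le (f := fun t (_ : t ∈ Ioi (1 : ℝ)) => 𝓝[stolzRegion t lam] lam) t ht le_rfl

theorem nonTangential_le_nhds (lam : ℂ) : nonTangential lam ≤ 𝓝 lam :=
  iSup₂_le fun _ _ => nhdsWithin_le_nhds

theorem eventually_norm_lt_one_nonTangential (lam : ℂ) :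
    ∀ᶠ z in nonTangential lam, ‖z‖ < 1 := by
  rw [nonTangential, eventually_iSup]
  intro t
  rw [eventually_iSup]
  intro _
  filter_upwards [self_mem_nhdsWithin] with z hz using hz.1

/-- The radius `r * lam`, `r → 1`, stays in every Stolz region, since its distance to `lam` is
exactly `1 - r`. -/
theorem nhdsWithin_stolzRegion_neBot {lam : ℂ} (hlam : ‖lam‖ = 1) {t : ℝ} (ht : 1 < t) :
    (𝓝[stolzRegion t lam] lam).NeBot := by
  have h1 : Tendsto (fun r : ℝ => (r : ℂ) * lam) (𝓝[<] 1) (𝓝[stolzRegion t lam] lam) := by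
    refine tendsto_nhdsWithin_iff.mpr ⟨?_, ?_⟩
    · have : Continuous fun r : ℝ => (r : ℂ) * lam := by fun_prop
      simpa using (this.tendsto 1).mono_left nhdsWithin_le_nhds
    · filter_upwards [Ioo_mem_nhdsLT (zero_lt_one (α := ℝ))] with r hr
      have hn : ‖(r : ℂ) * lam‖ = r := by simp [hlam, abs_of_pos hr.1]
      have hd : ‖(r : ℂ) * lam - lam‖ = 1 - r := by
        rw [show (r : ℂ) * lam - lam = ((r - 1 : ℝ) : ℂ) * lam by push_cast; ring, norm_mul, hlam,
          Complex.norm_real, Real.norm_eq_abs, abs_of_neg (by linarith [hr.2])]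
        ring
      refine ⟨by rw [hn]; exact hr.2, ?_⟩
      rw [hn, hd]
      nlinarith [hr.2]
  exact h1.neBot

/-- If a function that is analytic on the disc has an angular difference quotient at a boundary
point, then its derivative has the corresponding angular limit. -/
theorem tendsto_deriv_nonTangential {g : ℂ → ℂ} (hg : DifferentiableOn ℂ g (ball 0 1)) {lam : ℂ}
    (hlam : ‖lam‖ = 1) {c M : ℂ}
    (h : Tendsto (fun w => (1 - w * conj lam)⁻¹ * (c - g w)) (nonTangential lam) (𝓝 M)) :
    Tendsto (deriv g) (nonTangential lam) (𝓝 (conj lam * M)) := by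
  rw [tendsto_nonTangential_iff] at h ⊢
  intro t ht
  rw [Metric.tendsto_nhds]
  intro ε hε
  have hε' : 0 < ε / (2 * (2 * t + 1)) := by positivity
  -- Cauchy's estimate uses circles of radius `ρ = (1 - ‖z‖) / 2` about `z`. On them `‖ζ - lam‖ <
  -- 2tρ + ρ` and `ρ ≤ 1 - ‖ζ‖`, so they lie in the region of aperture `2t + 1`.
  have h1 := (Metric.tendsto_nhds.mp (h (2 * t + 1) (by linarith))) _ hε'
  rw [eventually_nhdsWithin_iff, Metric.eventually_nhds_iff] at h1
  obtain ⟨δ, hδ, h1⟩ := h1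
  have hnear : ∀ᶠ z in 𝓝[stolzRegion t lam] lam, dist z lam < δ / 2 :=
    nhdsWithin_le_nhds (Metric.ball_mem_nhds lam (half_pos hδ))
  filter_upwards [hnear, self_mem_nhdsWithin] with z hz hzt
  obtain ⟨hz1, hz2⟩ := hzt
  rw [dist_eq_norm] at hz
  set ρ : ℝ := (1 - ‖z‖) / 2 with hρ
  have hρ0 : 0 < ρ := by simp only [hρ]; linarith
  have hzl : 1 - ‖z‖ ≤ ‖z - lam‖ := by
    have := norm_sub_norm_le lam z
    rwa [hlam, norm_sub_rev] at this
  have hball : ∀ ζ ∈ closedBall z ρ, ρ ≤ 1 - ‖ζ‖ ∧ ‖ζ - lam‖ ≤ ‖z - lam‖ + ρ := by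
    intro ζ hζ
    rw [mem_closedBall, dist_eq_norm] at hζ
    constructor
    · have := norm_sub_norm_le ζ z
      simp only [hρ] at *
      linarith
    · calc ‖ζ - lam‖ = ‖(z - lam) + (ζ - z)‖ := by ring_nf
        _ ≤ _ := norm_add_le _ _
        _ ≤ _ := by linarith
  -- The error of the first-order expansion of `g` at `lam`; it is `o(‖ζ - lam‖)`, which on the
  -- circle is `o(ρ)`.
  set r : ℂ → ℂ := fun w => g w - c + M * (1 - w * conj lam) with hr
  have hgd : ∀ ζ ∈ closedBall z ρ, DifferentiableAt ℂ g ζ := fun ζ hζ =>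
    hg.differentiableAt (isOpen_ball.mem_nhds (by
      rw [mem_ball_zero_iff]; linarith [(hball ζ hζ).1]))
  have hrd : DiffContOnCl ℂ r (ball z ρ) := by
    refine DifferentiableOn.diffContOnCl_ball (U := closedBall z ρ) (fun ζ hζ => ?_) subset_rfl
    have := hgd ζ hζ
    exact DifferentiableAt.differentiableWithinAt (by fun_prop)
  have hbd : ∀ ζ ∈ sphere z ρ, ‖r ζ‖ ≤ ε / (2 * (2 * t + 1)) * ((2 * t + 1) * ρ) := by
    intro ζ hζ
    obtain ⟨b1, b2⟩ := hball ζ (sphere_subset_closedBall hζ)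
    have hb3 : ‖ζ - lam‖ < (2 * t + 1) * ρ := by
      have : 1 - ‖z‖ = 2 * ρ := by simp only [hρ]; ring
      rw [this] at hz2
      linarith
    have hst : ζ ∈ stolzRegion (2 * t + 1) lam :=
      ⟨by linarith, hb3.trans_le (by gcongr)⟩
    have hds : dist ζ lam < δ := by rw [dist_eq_norm]; simp only [hρ] at *; linarith
    have h2 := h1 hds hst
    rw [dist_eq_norm] at h2
    have hne : 1 - ζ * conj lam ≠ 0 := by
      rw [← norm_ne_zero_iff, norm_one_sub_mul_conj hlam, norm_ne_zero_iff, sub_ne_zero]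
      rintro rfl
      linarith
    have hrz : r ζ = -((1 - ζ * conj lam) * ((1 - ζ * conj lam)⁻¹ * (c - g ζ) - M)) := by
      rw [mul_sub, mul_inv_cancel_left₀ hne]
      simp only [hr]; ring
    rw [hrz, norm_neg, norm_mul, norm_one_sub_mul_conj hlam, mul_comm]
    gcongr
  have hcau := Complex.norm_deriv_le_of_forall_mem_sphere_norm_le hρ0 hrd hbd
  have hder : deriv r z = deriv g z - conj lam * M := by
    have h3 : HasDerivAt r (deriv g z + M * (0 - 1 * conj lam)) z :=
      ((hgd z (mem_closedBall_self hρ0.le)).hasDerivAt.sub_const c).add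
        ((((hasDerivAt_id z).mul_const (conj lam)).const_sub 1 |>.congr_deriv (by ring)).const_mul M)
    rw [h3.deriv]; ring
  rw [dist_eq_norm, ← hder]
  refine hcau.trans_lt ?_
  have : ε / (2 * (2 * t + 1)) * ((2 * t + 1) * ρ) / ρ = ε / 2 := by
    field_simp
  rw [this]
  linarith

/-! ### Kernels of `H(b)` and their boundary limits. -/

/-- The reproducing kernel `k^b_w x` of `H(b)`, extended by zero to `w` outside the disc. -/
noncomputable def dBRKerFun {n : ℕ} (b : SchurFunction n) (w : ℂ) (x : CVec n) :
    DeBrangesRovnyak b :=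
  if h : ‖w‖ < 1 then RKHS.kerFun (DeBrangesRovnyak b) (UnitDisc.mk w h) x else 0

section

variable {n : ℕ} {b : SchurFunction n}

theorem dBRKerFun_inner {w : ℂ} (hw : ‖w‖ < 1) (x : CVec n) (f : DeBrangesRovnyak b) :
    ⟪dBRKerFun b w x, f⟫_ℂ = ⟪x, f (UnitDisc.mk w hw)⟫_ℂ := by
  rw [dBRKerFun, dif_pos hw, RKHS.kerFun_inner]

theorem dBRKerFun_apply {w : ℂ} (hw : ‖w‖ < 1) (x : CVec n) (z : 𝔻) :
    dBRKerFun b w x z = (1 - (z : ℂ) * conj w)⁻¹ •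
      (x - b z (ContinuousLinearMap.adjoint (b w) x)) := by
  rw [dBRKerFun, dif_pos hw, RKHS.kerFun_apply, RKHS.OfKernel.kernel_ofKernel]
  simp [dBRKernel]

theorem norm_dBRKerFun_sq {w : ℂ} (hw : ‖w‖ < 1) (x : CVec n) :
    ‖dBRKerFun b w x‖ ^ 2 =
      (‖x‖ ^ 2 - ‖ContinuousLinearMap.adjoint (b w) x‖ ^ 2) / (1 - ‖w‖ ^ 2) := by
  have h1 : ((‖dBRKerFun b w x‖ ^ 2 : ℝ) : ℂ) =
      (((‖x‖ ^ 2 - ‖ContinuousLinearMap.adjoint (b w) x‖ ^ 2) / (1 - ‖w‖ ^ 2) : ℝ) : ℂ) := by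
    have h2 := inner_self_eq_norm_sq_to_K (𝕜 := ℂ) (dBRKerFun b w x)
    rw [dBRKerFun_inner hw, dBRKerFun_apply hw, inner_smul_right, inner_sub_right,
      UnitDisc.coe_mk, ← ContinuousLinearMap.adjoint_inner_left, inner_self_eq_norm_sq_to_K,
      inner_self_eq_norm_sq_to_K, Complex.mul_conj, Complex.normSq_eq_norm_sq] at h2
    push_cast at h2 ⊢
    rw [div_eq_inv_mul]
    exact h2.symm
  exact_mod_cast h1

/-- The weak limit of the kernels `k^b_w x`, when they are bounded, is a boundary kernel. -/
theorem exists_boundaryKernel_of_ultrafilter {lam : ℂ} (hlam : ‖lam‖ = 1) {x x' : CVec n}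
    (u : Ultrafilter ℂ) (hu : (u : Filter ℂ) ≤ 𝓝 lam)
    (hx : Tendsto (fun z => ContinuousLinearMap.adjoint (b z) x) u (𝓝 x')) {C : ℝ}
    (hu1 : ∀ᶠ w in (u : Filter ℂ), ‖w‖ < 1)
    (hC : ∀ᶠ w in (u : Filter ℂ), ‖dBRKerFun b w x‖ ≤ C) :
    ∃ h : DeBrangesRovnyak b,
      (∀ z : 𝔻, h z = (1 - (z : ℂ) * conj lam)⁻¹ • (x - b z x')) ∧
      ∀ f : DeBrangesRovnyak b,
        Tendsto (fun w => ⟪dBRKerFun b w x, f⟫_ℂ) u (𝓝 ⟪h, f⟫_ℂ) := by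
  obtain ⟨h, hh⟩ := exists_tendsto_inner_of_bounded u (fun w => dBRKerFun b w x) C hC
  refine ⟨h, fun z => ext_inner_right ℂ fun e => ?_, hh⟩
  -- Pairing with `k^b_z e` evaluates at `z`, so weak convergence forces pointwise convergence and
  -- identifies `h`.
  have h1 := hh (RKHS.kerFun (DeBrangesRovnyak b) z e)
  rw [RKHS.inner_kerFun] at h1
  refine tendsto_nhds_unique h1 ?_
  have hne : 1 - (z : ℂ) * conj lam ≠ 0 := by
    have := dBR_one_sub_ne_zero (z := conj lam) (w := conj (z : ℂ)) (by simp [hlam])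
      (by simpa using z.norm_lt_one)
    rwa [Complex.conj_conj, mul_comm] at this
  have h2 : Tendsto (fun w => (1 - (z : ℂ) * conj w)⁻¹ •
      (x - b z (ContinuousLinearMap.adjoint (b w) x))) u
      (𝓝 ((1 - (z : ℂ) * conj lam)⁻¹ • (x - b z x'))) := by
    refine Tendsto.smul (Tendsto.inv₀ ?_ hne) (((b z).continuous.tendsto x').comp hx |>.const_sub x)
    have : Continuous fun w : ℂ => 1 - (z : ℂ) * conj w :=
      continuous_const.sub (continuous_const.mul Complex.continuous_conj)
    exact (this.tendsto lam).mono_left hu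
  refine (h2.inner tendsto_const_nhds).congr' ?_
  filter_upwards [hu1] with w hw
  rw [RKHS.inner_kerFun, dBRKerFun_apply hw]

/-- The kernels `k^b_w x` are controlled by a boundary kernel. -/
theorem norm_dBRKerFun_mul_le {lam : ℂ} (hlam : ‖lam‖ = 1) {x x' : CVec n} (hn : ‖x'‖ = ‖x‖)
    {h : DeBrangesRovnyak b}
    (hh : ∀ z : 𝔻, h z = (1 - (z : ℂ) * conj lam)⁻¹ • (x - b z x')) {w : ℂ} (hw : ‖w‖ < 1) :
    ‖dBRKerFun b w x‖ * (1 - ‖w‖ ^ 2) ≤ 2 * ‖h‖ * ‖w - lam‖ := by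
  set k := dBRKerFun b w x with hk
  set y := ContinuousLinearMap.adjoint (b w) x with hy
  have hw2 : 0 < 1 - ‖w‖ ^ 2 := by nlinarith [norm_nonneg w]
  have hne : 1 - w * conj lam ≠ 0 := by
    rw [← norm_ne_zero_iff, norm_one_sub_mul_conj hlam, norm_ne_zero_iff, sub_ne_zero]
    rintro rfl
    linarith
  have h1 : ⟪x, x⟫_ℂ - ⟪y, x'⟫_ℂ = (1 - w * conj lam) * ⟪k, h⟫_ℂ := by
    rw [hk, dBRKerFun_inner hw, hh, inner_smul_right, UnitDisc.coe_mk, mul_inv_cancel_left₀ hne,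
      inner_sub_right, hy, ContinuousLinearMap.adjoint_inner_left]
  have h2 : ‖x‖ ^ 2 - (⟪y, x'⟫_ℂ).re ≤ ‖w - lam‖ * (‖k‖ * ‖h‖) := by
    have h3 := congrArg Complex.re h1
    rw [Complex.sub_re] at h3
    have h4 : (⟪x, x⟫_ℂ).re = ‖x‖ ^ 2 := inner_self_eq_norm_sq (𝕜 := ℂ) x
    rw [← h4, h3]
    refine (Complex.re_le_norm _).trans ?_
    rw [norm_mul, norm_one_sub_mul_conj hlam]
    gcongr
    exact norm_inner_le_norm _ _
  -- Expanded with `‖x'‖ = ‖x‖`, this gives `‖x‖² - ‖y‖² ≤ 2(‖x‖² - Re⟪y, x'⟫)`. With `h2` and `h6`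
  -- it bounds `‖k‖² (1 - ‖w‖²)` by a multiple of `‖k‖`, and one factor `‖k‖` cancels.
  have h5 : 0 ≤ ‖y - x'‖ ^ 2 := by positivity
  rw [norm_sub_sq (𝕜 := ℂ), hn, RCLike.re_to_complex] at h5
  have h6 : ‖k‖ ^ 2 * (1 - ‖w‖ ^ 2) = ‖x‖ ^ 2 - ‖y‖ ^ 2 := by
    rw [hk, norm_dBRKerFun_sq hw, div_mul_cancel₀ _ hw2.ne']
  rcases (norm_nonneg k).eq_or_lt with h0 | h0
  · rw [← h0]; simp only [zero_mul]; positivity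
  · refine le_of_mul_le_mul_left ?_ h0
    nlinarith

theorem norm_dBRKerFun_le_of_mem_stolzRegion {lam : ℂ} (hlam : ‖lam‖ = 1) {x x' : CVec n}
    (hn : ‖x'‖ = ‖x‖) {h : DeBrangesRovnyak b}
    (hh : ∀ z : 𝔻, h z = (1 - (z : ℂ) * conj lam)⁻¹ • (x - b z x')) {t : ℝ} {w : ℂ}
    (hw : w ∈ stolzRegion t lam) : ‖dBRKerFun b w x‖ ≤ 2 * ‖h‖ * t := by
  obtain ⟨hw1, hw2⟩ := hw
  have h1 := norm_dBRKerFun_mul_le hlam hn hh hw1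
  refine le_of_mul_le_mul_right ?_ (sub_pos.mpr hw1)
  calc ‖dBRKerFun b w x‖ * (1 - ‖w‖) ≤ ‖dBRKerFun b w x‖ * (1 - ‖w‖ ^ 2) := by
        gcongr; nlinarith [norm_nonneg w]
    _ ≤ 2 * ‖h‖ * ‖w - lam‖ := h1
    _ ≤ 2 * ‖h‖ * (t * (1 - ‖w‖)) := by gcongr
    _ = _ := by ring

/-- Every function in `H(b)` has an angular limit in the direction of a boundary kernel. -/
theorem tendsto_dBRKerFun_inner {lam : ℂ} (hlam : ‖lam‖ = 1) {x x' : CVec n} (hn : ‖x'‖ = ‖x‖)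
    (hx : Tendsto (fun z => ContinuousLinearMap.adjoint (b z) x) (nonTangential lam) (𝓝 x'))
    {h : DeBrangesRovnyak b}
    (hh : ∀ z : 𝔻, h z = (1 - (z : ℂ) * conj lam)⁻¹ • (x - b z x')) (f : DeBrangesRovnyak b) :
    Tendsto (fun w => ⟪dBRKerFun b w x, f⟫_ℂ) (nonTangential lam) (𝓝 ⟪h, f⟫_ℂ) := by
  rw [tendsto_nonTangential_iff]
  intro t ht
  rw [tendsto_iff_ultrafilter]
  intro u hu
  have hu' := hu.trans (nhdsWithin_stolzRegion_le_nonTangential ht lam)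
  have hst : ∀ᶠ w in (u : Filter ℂ), w ∈ stolzRegion t lam := hu self_mem_nhdsWithin
  obtain ⟨h', hh', hf⟩ := exists_boundaryKernel_of_ultrafilter (C := 2 * ‖h‖ * t) hlam u
    (hu.trans nhdsWithin_le_nhds) (hx.mono_left hu') (hst.mono fun w hw => hw.1)
    (hst.mono fun w hw => norm_dBRKerFun_le_of_mem_stolzRegion hlam hn hh hw)
  -- The point values do not depend on the ultrafilter, so all weak limits agree.
  have : h' = h := RKHS.ext fun z => by rw [hh, hh']
  exact this ▸ hf f

/-- The Carathéodory condition amounts to the boundary kernel being in `H(b)`. -/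
theorem caratheodoryCondition_iff_exists_boundaryKernel {lam : ℂ} (hlam : ‖lam‖ = 1)
    {x x' : CVec n} (hn : ‖x'‖ = ‖x‖)
    (hx : Tendsto (fun z => ContinuousLinearMap.adjoint (b z) x) (nonTangential lam) (𝓝 x')) :
    CaratheodoryCondition b lam x ↔ ∃ h : DeBrangesRovnyak b,
      ∀ z : 𝔻, h z = (1 - (z : ℂ) * conj lam)⁻¹ • (x - b z x') := by
  constructor
  · intro hc
    obtain ⟨C, hC, -⟩ := EReal.lt_iff_exists_real_btwn.mp hc
    have hfr := frequently_lt_of_liminf_lt (by isBoundedDefault) hC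
    -- A finite lower limit bounds the quotient only frequently; an ultrafilter finer than the
    -- approach and concentrated on that set suffices for a weak limit.
    obtain ⟨u, hu⟩ := exists_ultrafilter_iff.mpr (frequently_iff_neBot.mp hfr)
    have hu1 := hu.trans inf_le_left
    have hu2 : ∀ᶠ w in (u : Filter ℂ), _ := le_principal_iff.mp (hu.trans inf_le_right)
    have hlt := (eventually_norm_lt_one_nonTangential lam).filter_mono hu1
    obtain ⟨h, hh, -⟩ := exists_boundaryKernel_of_ultrafilter (C := Real.sqrt C) hlam u
      (hu1.trans (nonTangential_le_nhds lam)) (hx.mono_left hu1) hlt (by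
        filter_upwards [hlt, hu2] with w hw hwC
        refine Real.le_sqrt_of_sq_le ?_
        rw [norm_dBRKerFun_sq hw]
        exact (EReal.coe_lt_coe_iff.mp hwC).le)
    exact ⟨h, hh⟩
  · rintro ⟨h, hh⟩
    have := nhdsWithin_stolzRegion_neBot hlam (one_lt_two (α := ℝ))
    have hev : ∀ᶠ w in 𝓝[stolzRegion 2 lam] lam,
        (((‖x‖ ^ 2 - ‖ContinuousLinearMap.adjoint (b w) x‖ ^ 2) / (1 - ‖w‖ ^ 2) : ℝ) : EReal) ≤
          (((2 * ‖h‖ * 2) ^ 2 : ℝ) : EReal) := by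
      filter_upwards [self_mem_nhdsWithin] with w hw
      rw [EReal.coe_le_coe_iff, ← norm_dBRKerFun_sq hw.1]
      gcongr
      exact norm_dBRKerFun_le_of_mem_stolzRegion hlam hn hh hw
    exact (liminf_le_of_frequently_le' (hev.frequently.filter_mono
      (nhdsWithin_stolzRegion_le_nonTangential one_lt_two lam))).trans_lt (EReal.coe_lt_top _)

end

/-! ### The subspace `E` and its angular derivative. -/

theorem norm_adjoint_unitary_apply {n : ℕ} (α : unitary (CMat n)) (x : CVec n) :
    ‖ContinuousLinearMap.adjoint (α : CMat n) x‖ = ‖x‖ :=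
  ContinuousLinearMap.norm_map_of_mem_unitary (Unitary.star_mem α.2) x

/-- The lower limit is not visibly linear in `x`; the existence of the boundary kernel is, which
yields closure under sums and multiples. -/
theorem mem_caratheodoryCodirections_iff {n : ℕ} {b : SchurFunction n} {α : unitary (CMat n)}
    {lam : ℂ} (hlam : ‖lam‖ = 1) {x : CVec n} :
    x ∈ caratheodoryCodirections b α lam ↔ x ∈ directionalCarrier b α lam ∧
      ∃ h : DeBrangesRovnyak b, ∀ z : 𝔻, h z = (1 - (z : ℂ) * conj lam)⁻¹ •
        (x - b z (ContinuousLinearMap.adjoint (α : CMat n) x)) :=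
  and_congr_right fun hx =>
    caratheodoryCondition_iff_exists_boundaryKernel hlam (norm_adjoint_unitary_apply α x) hx

/-- `E_α(lam)` as a linear subspace. -/
def caratheodorySubspace {n : ℕ} (b : SchurFunction n) (α : unitary (CMat n)) {lam : ℂ}
    (hlam : ‖lam‖ = 1) : Submodule ℂ (CVec n) where
  carrier := caratheodoryCodirections b α lam
  zero_mem' := by
    refine (mem_caratheodoryCodirections_iff hlam).mpr ⟨?_, 0, fun z => ?_⟩
    · simpa [directionalCarrier] using tendsto_const_nhds
    · simp
  add_mem' := by
    intro x y hx hy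
    rw [mem_caratheodoryCodirections_iff hlam] at hx hy ⊢
    obtain ⟨hx, f, hf⟩ := hx
    obtain ⟨hy, g, hg⟩ := hy
    refine ⟨?_, f + g, fun z => ?_⟩
    · simp only [directionalCarrier, mem_ofPred_eq, map_add] at hx hy ⊢
      exact hx.add hy
    · rw [RKHS.coe_add, Pi.add_apply, hf, hg, ← smul_add, map_add, map_add]
      congr 1
      abel
  smul_mem' := by
    intro c x hx
    rw [mem_caratheodoryCodirections_iff hlam] at hx ⊢
    obtain ⟨hx, f, hf⟩ := hx
    refine ⟨?_, c • f, fun z => ?_⟩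
    · simp only [directionalCarrier, mem_ofPred_eq, map_smul] at hx ⊢
      exact hx.const_smul c
    · rw [RKHS.coe_smul, Pi.smul_apply, hf, smul_comm, map_smul, map_smul, smul_sub]

/-- The boundary kernels depend linearly on the direction. -/
theorem exists_linearMap_boundaryKernel {n : ℕ} (b : SchurFunction n) (α : unitary (CMat n))
    {lam : ℂ} (hlam : ‖lam‖ = 1) :
    ∃ K : caratheodorySubspace b α hlam →ₗ[ℂ] DeBrangesRovnyak b, ∀ x (z : 𝔻),
      K x z = (1 - (z : ℂ) * conj lam)⁻¹ •
        ((x : CVec n) - b z (ContinuousLinearMap.adjoint (α : CMat n) x)) := by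
  have h : ∀ x : caratheodorySubspace b α hlam, ∃ h : DeBrangesRovnyak b, ∀ z : 𝔻,
      h z = (1 - (z : ℂ) * conj lam)⁻¹ •
        ((x : CVec n) - b z (ContinuousLinearMap.adjoint (α : CMat n) x)) :=
    fun x => ((mem_caratheodoryCodirections_iff hlam).mp x.2).2
  choose K hK using h
  refine ⟨⟨⟨K, fun x y => RKHS.ext fun z => ?_⟩, fun c x => RKHS.ext fun z => ?_⟩, hK⟩
  · rw [RKHS.coe_add, Pi.add_apply, hK, hK, hK, ← smul_add, Submodule.coe_add, map_add, map_add]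
    congr 1
    abel
  · rw [RKHS.coe_smul, Pi.smul_apply, hK, hK, RingHom.id_apply, Submodule.coe_smul, map_smul,
      map_smul, smul_comm c, ← smul_sub]

/-- A family of contractions whose adjoints carry `e` asymptotically to `e'`, with `‖e'‖ = ‖e‖`,
carries `e'` asymptotically to `e`. -/
theorem tendsto_apply_of_tendsto_adjoint_apply {ι F : Type*} [NormedAddCommGroup F]
    [InnerProductSpace ℂ F] [CompleteSpace F] {l : Filter ι} {T : ι → F →L[ℂ] F} {e e' : F}
    (hT : ∀ᶠ i in l, ‖T i‖ ≤ 1) (hn : ‖e'‖ = ‖e‖)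
    (h : Tendsto (fun i => ContinuousLinearMap.adjoint (T i) e) l (𝓝 e')) :
    Tendsto (fun i => T i e') l (𝓝 e) := by
  rw [tendsto_iff_norm_sub_tendsto_zero]
  -- This majorizes `‖T i e' - e‖²`: expand the square and use `‖T i e'‖ ≤ ‖e‖`.
  have h1 : Tendsto (fun i => 2 * ‖e‖ ^ 2 -
      2 * (⟪e', ContinuousLinearMap.adjoint (T i) e⟫_ℂ).re) l (𝓝 0) := by
    have h2 := (Complex.continuous_re.tendsto _).comp
      ((tendsto_const_nhds (x := e')).inner h : Tendsto (fun i => ⟪e', _⟫_ℂ) l _)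
    have h3 : (⟪e', e'⟫_ℂ).re = ‖e‖ ^ 2 := by rw [← hn]; exact inner_self_eq_norm_sq (𝕜 := ℂ) e'
    rw [h3] at h2
    rw [← sub_self (2 * ‖e‖ ^ 2)]
    exact (h2.const_mul 2).const_sub (2 * ‖e‖ ^ 2)
  have h4 : Tendsto (fun i => ‖T i e' - e‖ ^ 2) l (𝓝 0) := by
    refine squeeze_zero' (Eventually.of_forall fun i => by positivity) ?_ h1
    filter_upwards [hT] with i hi
    rw [norm_sub_sq (𝕜 := ℂ), ContinuousLinearMap.adjoint_inner_right, RCLike.re_to_complex]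
    have h5 : ‖T i e'‖ ≤ ‖e‖ := by
      simpa [hn] using (T i).le_of_opNorm_le hi e'
    nlinarith [norm_nonneg (T i e')]
  simpa [Real.sqrt_sq] using h4.sqrt

theorem theorem8p1 {n : ℕ} (b : SchurFunction n) (α : unitary (CMat n)) (lam : ℂ)
    (hlam : ‖lam‖ = 1) :
    ∃ E : Submodule ℂ (CVec n), (E : Set (CVec n)) = caratheodoryCodirections b α lam ∧
      ∃ A : CMat n, HasCADOn (fun z => b z ∘L ContinuousLinearMap.adjoint (α : CMat n)) lam E A ∧
        ∃ k : E → DeBrangesRovnyak b,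
          (∀ x : E, IsBoundaryKernel b lam (x : CVec n) (k x)) ∧
          ∀ x y : E, lam * ⟪(y : CVec n), A (x : CVec n)⟫_ℂ = ⟪k y, k x⟫_ℂ := by
  set E := caratheodorySubspace b α hlam
  have hEt : ∀ e ∈ E, Tendsto (fun z => ContinuousLinearMap.adjoint (b z) e) (nonTangential lam)
      (𝓝 (ContinuousLinearMap.adjoint (α : CMat n) e)) := fun e he => he.1
  obtain ⟨K, hK⟩ := exists_linearMap_boundaryKernel b α hlam
  have hlt := eventually_norm_lt_one_nonTangential lam
  let KP : CVec n →L[ℂ] DeBrangesRovnyak b :=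
    LinearMap.toContinuousLinearMap (K ∘ₗ (E.orthogonalProjectionOnto : CVec n →ₗ[ℂ] E))
  have hKP : ∀ v, KP v = K (E.orthogonalProjectionOnto v) := fun v => rfl
  -- Precomposing `K` with the projection makes `A` vanish on the orthogonal complement of `E` and
  -- take values in `E`, as a limit of compressions must. The factor `conj lam` comes from
  -- differentiating `1 - w * conj lam`.
  let A : CMat n := conj lam • (ContinuousLinearMap.adjoint KP ∘L KP)
  have hA : ∀ u v, ⟪u, A v⟫_ℂ = conj lam * ⟪KP u, KP v⟫_ℂ := fun u v => by
    simp [A, ContinuousLinearMap.adjoint_inner_right]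
  refine ⟨E, rfl, A, ⟨fun e he => ?_, ?_⟩, K, fun x => ?_, fun x y => ?_⟩
  · exact tendsto_apply_of_tendsto_adjoint_apply (T := fun z => b z)
      (hlt.mono fun z hz => (b.norm_lt_one z (by simpa using hz)).le)
      (norm_adjoint_unitary_apply α e) (hEt e he)
  · refine tendsto_clm_of_tendsto_inner fun u v => ?_
    set x : E := E.orthogonalProjectionOnto u
    set y : E := E.orthogonalProjectionOnto v
    let y' : CVec n := ContinuousLinearMap.adjoint (α : CMat n) y
    rw [hA, hKP, hKP]
    -- Weak convergence tested on `K y` is the angular limit of the difference quotient of `⟪x, b z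
    -- y'⟫`.
    have h1 := tendsto_dBRKerFun_inner hlam (norm_adjoint_unitary_apply α x) (hEt x x.2) (hK x)
      (K y)
    have hgd : DifferentiableOn ℂ (fun z => ⟪(x : CVec n), b z y'⟫_ℂ) (ball 0 1) :=
      (innerSL ℂ (x : CVec n)).differentiable.comp_differentiableOn
        (b.differentiableOn.clm_apply (differentiableOn_const y'))
    have h2 := tendsto_deriv_nonTangential hgd hlam (c := ⟪(x : CVec n), (y : CVec n)⟫_ℂ)
      (h1.congr' (by
        filter_upwards [hlt] with w hw
        rw [dBRKerFun_inner hw, hK, UnitDisc.coe_mk, inner_smul_right, inner_sub_right]))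
    refine h2.congr' ?_
    filter_upwards [hlt] with w hw
    have hd : HasDerivAt b.toFun (deriv b.toFun w) w :=
      (b.differentiableOn.differentiableAt (isOpen_ball.mem_nhds (by simpa using hw))).hasDerivAt
    have hd1 : HasDerivAt (fun z => b z ∘L ContinuousLinearMap.adjoint (α : CMat n))
        (deriv b.toFun w ∘L ContinuousLinearMap.adjoint (α : CMat n)) w := by
      simpa using hd.clm_comp (hasDerivAt_const w (ContinuousLinearMap.adjoint (α : CMat n)))
    have hd2 : HasDerivAt (fun z => ⟪(x : CVec n), b z y'⟫_ℂ)
        ⟪(x : CVec n), deriv b.toFun w y'⟫_ℂ w := by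
      have h3 : HasDerivAt (fun z => b z y') (deriv b.toFun w y') w := by
        simpa using hd.clm_apply (hasDerivAt_const w y')
      exact (innerSL ℂ (x : CVec n)).hasFDerivAt.comp_hasDerivAt w h3
    rw [hd1.deriv, hd2.deriv]
    simp only [ContinuousLinearMap.comp_apply]
    rw [← E.inner_starProjection_left_eq_right]
    rfl
  · exact ⟨_, hEt x x.2, hK x⟩
  · have hmul : lam * conj lam = 1 := by
      simp [Complex.mul_conj, Complex.normSq_eq_norm_sq, hlam]
    rw [hA, ← mul_assoc, hmul, one_mul, hKP, hKP]
    simp
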